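/- Fix $k\in\mathbb N$. A ($k$-dimensional, nondeterministic) vector addition system with states, $k$-VASS, $V$ consists of a finite alphabet $\Sigma$, a finite set $Q$ of states, an initial configuration $c_0\in Q\times\mathbb N^k$, a finite set $F\subseteq Q\times\mathbb N^k$ of final configurations and a finite set $\delta\subseteq Q\times\Sigma\times\mathbb Z^k\times Q$ of transitions. A transition $(s,a,v,s')$ reads the letter $a$; it can be fired in a configuration $q(u)\in Q\times\mathbb N^k$ if and only if $q=s$ and $u+v\ge 0$ componentwise, and it then leads to the configuration $s'(u+v)$. A run is a finite sequence of transitions that can be fired one after another; it is accepting if it starts in $c_0$ and ends in a configuration $q(u)$ such that $u\ge u'$ componentwise for some $q(u')\in F$. The (coverability) language $L(V)\subseteq\Sigma^*$ is the set of words read by accepting runs. $V$ is unambiguous if every $w\in L(V)$ is read by exactly one accepting run. It is undecidable whether $L(A)\subseteq L(B)$ for a given unambiguous 2-VASS $A$ and a given nondeterministic 2-VASS $B$ over the same finite alphabet. That is, there is no algorithm which, on every input consisting of (finite descriptions of) an unambiguous 2-VASS $A$ and an arbitrary 2-VASS $B$ over the same finite alphabet, halts and answers correctly whether $L(A)\subseteq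 L(B)$; nothing is required of the algorithm on inputs in which $A$ is not unambiguous. -/

import Mathlib

/-- A transition `(src, letter, eff, tgt)` of a `k`-dimensional VASS: it leaves the state `src`,
reads `letter`, adds `eff` to the counters and enters the state `tgt`. -/
@[ext]
structure VASSTransition (k : ℕ) (α Q : Type) where
  src : Q
  letter : α
  eff : Fin k → ℤ
  tgt : Q

/-- A `k`-dimensional vector addition system with states (`k`-VASS) over the alphabet `α` with
set of states `Q`: an initial configuration, a finite set of final configurations and a finite
set of transitions. It is nondeterministic in general. -/
@[ext]
structure VASS (k : ℕ) (α Q : Type) where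
  init : Q × (Fin k → ℕ)
  final : Finset (Q × (Fin k → ℕ))
  trans : Finset (VASSTransition k α Q)

namespace VASS

variable {k : ℕ} {α Q : Type}

/-- Firing `t` in the configuration `c` is possible and leads to the configuration `d`.
Counters of configurations are natural numbers, so this includes that they stay non-negative. -/
def Fires (t : VASSTransition k α Q) (c d : Q × (Fin k → ℕ)) : Prop :=
  c.1 = t.src ∧ d.1 = t.tgt ∧ ∀ i, (d.2 i : ℤ) = (c.2 i : ℤ) + t.eff i

/-- `V.IsRun c ρ d`: the sequence `ρ` of transitions of `V` can be fired one after another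
from the configuration `c`, and leads to the configuration `d`. -/
def IsRun (V : VASS k α Q) :
    Q × (Fin k → ℕ) → List (VASSTransition k α Q) → Q × (Fin k → ℕ) → Prop
  | c, [], d => c = d
  | c, t :: ρ, d => t ∈ V.trans ∧ ∃ e, Fires t c e ∧ IsRun V e ρ d

/-- A configuration is accepting if it covers some final configuration. -/
def IsAccepting (V : VASS k α Q) (c : Q × (Fin k → ℕ)) : Prop :=
  ∃ f ∈ V.final, c.1 = f.1 ∧ ∀ i, f.2 i ≤ c.2 i

/-- `ρ` is an accepting run of `V` over the word `w`. -/
def IsAcceptingRunOver (V : VASS k α Q) (ρ : List (VASSTransition k α Q)) (w : List α) : Prop :=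
  ρ.map VASSTransition.letter = w ∧ ∃ c, V.IsRun V.init ρ c ∧ V.IsAccepting c

/-- The (coverability) language of `V`: all words read by accepting runs. -/
def language (V : VASS k α Q) : Language α :=
  {w | ∃ ρ, V.IsAcceptingRunOver ρ w}

/-- `V` is unambiguous: every word of its language has exactly one accepting run. -/
def Unambiguous (V : VASS k α Q) : Prop :=
  ∀ w ∈ V.language, ∃! ρ, V.IsAcceptingRunOver ρ w

/-- The finite data by which a `k`-VASS with states and letters numbered from `0` is handed to an
algorithm: the number of letters and the number of states, the initial configuration, a list of
the final configurations, and a list of the transitions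
`(source, letter, effect, target)`. -/
abbrev Code (k : ℕ) : Type :=
  (ℕ × ℕ) × (ℕ × (Fin k → ℕ)) × List (ℕ × (Fin k → ℕ)) × List (ℕ × ℕ × (Fin k → ℤ) × ℕ)

/-- `V.IsCode c`: the data `c` describes the VASS `V`. -/
structure IsCode {m n : ℕ} (V : VASS k (Fin m) (Fin n)) (c : Code k) : Prop where
  sizes : c.1 = (m, n)
  init : c.2.1 = ((V.init.1 : ℕ), V.init.2)
  final : ∀ x, x ∈ c.2.2.1 ↔ ∃ f ∈ V.final, x = ((f.1 : ℕ), f.2)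
  trans : ∀ x, x ∈ c.2.2.2 ↔
    ∃ t ∈ V.trans, x = ((t.src : ℕ), (t.letter : ℕ), t.eff, (t.tgt : ℕ))

end VASS

/-!
A two-counter machine accepts an input if the automaton which describes its control accepts some
word over the operations of incrementing, decrementing and testing for zero whose operations can be
executed one after another. Let `A` be the 2-VASS which follows this automaton and executes the
increments and the decrements, but does not check the zero tests, and let `B` be the 2-VASS which
guesses some zero test in the word and checks by a decrement that the tested counter is nonzero.
Then `A` is deterministic, and a word of `L(A)` lies outside `L(B)` exactly if all its zero tests
succeed, so `L(A) ⊆ L(B)` exactly if the machine does not accept its input. The inputs become the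
initial values of the counters, so that the machine is fixed and only initial configurations vary.

For the undecidability of the acceptance problem, a program is identified with the relation between
memory contents which it computes. The relations computed by two-counter machines are closed under
composition, union and iteration, because regular languages are closed under product, union and
star; the class grows from counters to registers by Gödel numbering, from registers to lists and
stacks by numbering lists, and then contains all partial recursive functions.
-/

open Function Relation Turing

section KleeneClosed

variable {T U : Type*} {C : (T → T → Prop) → Prop}

/-- A class of binary relations on `T` closed under the operations of Kleene algebra. -/
structure KleeneClosed (C : (T → T → Prop) → Prop) : Prop where
  one : C fun a b => b = a
  zero : C fun _ _ => False
  comp {R S} : C R → C S → C (Comp R S)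
  union {R S} : C R → C S → C fun a b => R a b ∨ S a b
  star {R} : C R → C (ReflTransGen R)

/-- The graph of the restriction of the map `f` to the domain `P`, as a binary relation: the
meaning of the instruction which checks `P` and then applies `f`. -/
def guardedMap (P : T → Prop) (f : T → T) (a b : T) : Prop := P a ∧ b = f a

theorem mem_class_congr {R S : T → T → Prop} (hR : C R) (h : ∀ a b, R a b ↔ S a b) : C S :=
  (funext₂ fun a b => propext (h a b) : R = S) ▸ hR

theorem guardedMap_congr {P Q : T → Prop} {f g : T → T} (h : C (guardedMap P f))
    (hPQ : ∀ a, P a ↔ Q a) (hfg : ∀ a, Q a → f a = g a) : C (guardedMap Q g) :=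
  mem_class_congr h fun a b => and_congr (hPQ a) Iff.rfl |>.trans
    (and_congr_right fun hQ => by rw [hfg a hQ])

theorem comp_guardedMap {P Q : T → Prop} {f g : T → T} :
    Comp (guardedMap P f) (guardedMap Q g) = guardedMap (fun a => P a ∧ Q (f a)) (g ∘ f) := by
  ext a b
  constructor
  · rintro ⟨_, ⟨hP, rfl⟩, hQ, rfl⟩
    exact ⟨⟨hP, hQ⟩, rfl⟩
  · rintro ⟨⟨hP, hQ⟩, rfl⟩
    exact ⟨f a, ⟨hP, rfl⟩, hQ, rfl⟩

namespace KleeneClosed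

theorem id (hC : KleeneClosed C) : C (guardedMap (fun _ => True) id) :=
  mem_class_congr hC.one fun a b => by simp [guardedMap]

theorem seq (hC : KleeneClosed C) {P Q : T → Prop} {f g : T → T} (hf : C (guardedMap P f))
    (hg : C (guardedMap Q g)) : C (guardedMap (fun a => P a ∧ Q (f a)) (g ∘ f)) :=
  comp_guardedMap ▸ hC.comp hf hg

theorem iUnion_finset (hC : KleeneClosed C) {κ : Type*} (s : Finset κ) {R : κ → T → T → Prop}
    (hR : ∀ i ∈ s, C (R i)) : C fun a b => ∃ i ∈ s, R i a b := by
  classical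
  induction s using Finset.induction_on with
  | empty => exact mem_class_congr hC.zero (by simp)
  | insert i s _ ih =>
    refine mem_class_congr (hC.union (hR i (by simp)) (ih fun j hj => hR j (by simp [hj]))) ?_
    simp

end KleeneClosed

/-- The relations `R` such that `C` contains both `R` and its converse. -/
def Reversible (C : (T → T → Prop) → Prop) (R : T → T → Prop) : Prop := C R ∧ C (flip R)

theorem KleeneClosed.reversible (hC : KleeneClosed C) : KleeneClosed (Reversible C) where
  one := ⟨hC.one, mem_class_congr hC.one fun _ _ => eq_comm⟩
  zero := ⟨hC.zero, hC.zero⟩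
  comp hR hS := ⟨hC.comp hR.1 hS.1, flip_comp ▸ hC.comp hS.2 hR.2⟩
  union hR hS := ⟨hC.union hR.1 hS.1, hC.union hR.2 hS.2⟩
  star hR := ⟨hC.star hR.1, mem_class_congr (hC.star hR.2) fun _ _ => reflTransGen_swap⟩

theorem Reversible.range (hC : KleeneClosed C) {P : T → Prop} {f : T → T}
    (h : Reversible C (guardedMap P f)) : C (guardedMap (fun b => ∃ a, P a ∧ b = f a) id) := by
  refine mem_class_congr (hC.comp h.2 h.1) fun b c => ?_
  constructor
  · rintro ⟨a, ⟨hP, hb⟩, -, hc⟩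
    exact ⟨⟨a, hP, hb⟩, hc.trans hb.symm⟩
  · rintro ⟨⟨a, hP, hb⟩, hc⟩
    exact ⟨a, ⟨hP, hb⟩, hP, hc.trans hb⟩

/-- The relations on `U` which are simulated, through the encoding `φ`, by a relation of `C`. -/
def Simulated (φ : U → T) (C : (T → T → Prop) → Prop) (R : U → U → Prop) : Prop :=
  ∃ R₀, C R₀ ∧ ∀ a b, R₀ (φ a) b ↔ ∃ b', R a b' ∧ φ b' = b

theorem KleeneClosed.simulated (hC : KleeneClosed C) (φ : U → T) :
    KleeneClosed (Simulated φ C) where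
  one := ⟨_, hC.one, fun a b => by simp [eq_comm]⟩
  zero := ⟨_, hC.zero, fun a b => by simp⟩
  comp := by
    rintro R S ⟨R₀, hR, hR'⟩ ⟨S₀, hS, hS'⟩
    refine ⟨_, hC.comp hR hS, fun a b => ?_⟩
    constructor
    · rintro ⟨c, hac, hcb⟩
      obtain ⟨c', hc', rfl⟩ := (hR' _ _).1 hac
      obtain ⟨b', hb', rfl⟩ := (hS' _ _).1 hcb
      exact ⟨b', ⟨c', hc', hb'⟩, rfl⟩
    · rintro ⟨b', ⟨c', hc', hb'⟩, rfl⟩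
      exact ⟨φ c', (hR' _ _).2 ⟨c', hc', rfl⟩, (hS' _ _).2 ⟨b', hb', rfl⟩⟩
  union := by
    rintro R S ⟨R₀, hR, hR'⟩ ⟨S₀, hS, hS'⟩
    refine ⟨_, hC.union hR hS, fun a b => ?_⟩
    simp only [hR', hS', ← exists_or, or_and_right]
  star := by
    rintro R ⟨R₀, hR, hR'⟩
    refine ⟨_, hC.star hR, fun a b => ?_⟩
    constructor
    · intro h
      induction h with
      | refl => exact ⟨a, .refl, rfl⟩
      | tail _ h ih =>
        obtain ⟨c, hc, rfl⟩ := ih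
        obtain ⟨d, hd, rfl⟩ := (hR' _ _).1 h
        exact ⟨d, hc.tail hd, rfl⟩
    · rintro ⟨b', h, rfl⟩
      exact h.lift φ fun x y hxy => (hR' _ _).2 ⟨y, hxy, rfl⟩

theorem Simulated.guardedMap {φ : U → T} {P : T → Prop} {f : T → T} {Q : U → Prop} {g : U → U}
    (h : C (guardedMap P f)) (hPQ : ∀ a, P (φ a) ↔ Q a) (hfg : ∀ a, Q a → f (φ a) = φ (g a)) :
    Simulated φ C (guardedMap Q g) := by
  refine ⟨_, h, fun a b => ?_⟩
  constructor
  · rintro ⟨hP, rfl⟩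
    have hQ := (hPQ a).1 hP
    exact ⟨g a, ⟨hQ, rfl⟩, (hfg a hQ).symm⟩
  · rintro ⟨_, ⟨hQ, rfl⟩, rfl⟩
    exact ⟨(hPQ a).2 hQ, (hfg a hQ).symm⟩

end KleeneClosed

section RegisterMachine

variable {ι : Type*} [DecidableEq ι] {C : ((ι → ℕ) → (ι → ℕ) → Prop) → Prop}

/-- A Kleene closed class of relations between valuations of the registers `ι` which contains the
instructions of a register machine: increments, decrements (the converses of the increments) and
zero tests. -/
structure RegisterClosed (C : ((ι → ℕ) → (ι → ℕ) → Prop) → Prop) : Prop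
    extends KleeneClosed C where
  inc (i : ι) : C fun s t => t = update s i (s i + 1)
  dec (i : ι) : C fun s t => s = update t i (t i + 1)
  isZero (i : ι) : C (guardedMap (fun s => s i = 0) id)

theorem reflTransGen_countdown_iff {i : ι} {P : (ι → ℕ) → Prop} {f : (ι → ℕ) → ι → ℕ}
    (hfP : ∀ s, P s → P (f s)) (hPi : ∀ s n, P (update s i n) ↔ P s)
    (hfi : ∀ s n, f (update s i n) = update (f s) i n) {n : ℕ} {s t : ι → ℕ} (hs : s i = n)
    (hPs : P s) :
    ReflTransGen (Comp (guardedMap (fun s => s i ≠ 0) fun s => update s i (s i - 1))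
      (guardedMap P f)) s t ∧ t i = 0 ↔ t = update (f^[n] s) i 0 := by
  induction n generalizing s with
  | zero =>
    have hupdate : update s i 0 = s := by rw [← hs, update_eq_self]
    rw [ReflTransGen.cases_head_iff, iterate_zero_apply, hupdate]
    constructor
    · rintro ⟨rfl | ⟨_, ⟨_, ⟨hi, -⟩, -⟩, -⟩, -⟩
      · rfl
      · exact absurd hs hi
    · intro h
      exact ⟨Or.inl h.symm, (congrFun h i).trans hs⟩
  | succ n ih =>
    have hstep (c : ι → ℕ) : Comp (guardedMap (fun s => s i ≠ 0) fun s => update s i (s i - 1))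
        (guardedMap P f) s c ↔ c = update (f s) i n := by
      rw [comp_guardedMap]
      simp [guardedMap, hs, hPi, hPs, hfi]
    have hiter : f^[n] (update (f s) i n) = update (f^[n] (f s)) i n :=
      (Function.Commute.iterate_left (g := (update · i n)) (fun s => hfi s n) n).eq (f s)
    have hne : s ≠ t ∨ t i ≠ 0 := by
      by_contra! h
      simp [h.1, h.2] at hs
    have hrest := ih (s := update (f s) i n) (by simp) ((hPi _ _).2 (hfP s hPs))
    rw [hiter, update_idem] at hrest
    rw [ReflTransGen.cases_head_iff, iterate_succ_apply, ← hrest]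
    simp only [hstep, exists_eq_left]
    tauto

namespace RegisterClosed

theorem reversible (hC : RegisterClosed C) : RegisterClosed (Reversible C) where
  toKleeneClosed := hC.toKleeneClosed.reversible
  inc i := ⟨hC.inc i, hC.dec i⟩
  dec i := ⟨hC.dec i, hC.inc i⟩
  isZero i := ⟨hC.isZero i, mem_class_congr (hC.isZero i) fun s t => by
    simp only [guardedMap, flip]
    constructor <;> rintro ⟨h, rfl⟩ <;> exact ⟨h, rfl⟩⟩

theorem pred (hC : RegisterClosed C) (i : ι) :
    C (guardedMap (fun s => s i ≠ 0) fun s => update s i (s i - 1)) := by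
  refine mem_class_congr (hC.dec i) fun s t => ?_
  constructor
  · rintro rfl
    exact ⟨by simp, by simp⟩
  · rintro ⟨h, rfl⟩
    simp [Nat.sub_add_cancel (Nat.pos_of_ne_zero h)]

theorem add (hC : RegisterClosed C) (i : ι) (n : ℕ) :
    C (guardedMap (fun _ => True) fun s => update s i (s i + n)) := by
  induction n with
  | zero => exact guardedMap_congr hC.id (by simp) (by simp)
  | succ n ih =>
    have hinc : C (guardedMap (fun _ => True) fun s => update s i (s i + 1)) :=
      mem_class_congr (hC.inc i) fun s t => by simp [guardedMap]
    exact guardedMap_congr (hC.seq ih hinc) (by simp) (by simp [add_assoc])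

theorem forLoop (hC : RegisterClosed C) (i : ι) {P : (ι → ℕ) → Prop} {f : (ι → ℕ) → ι → ℕ}
    (hP : C (guardedMap P id)) (hf : C (guardedMap P f)) (hfP : ∀ s, P s → P (f s))
    (hPi : ∀ s n, P (update s i n) ↔ P s) (hfi : ∀ s n, f (update s i n) = update (f s) i n) :
    C (guardedMap P fun s => update (f^[s i] s) i 0) := by
  have hloop (s t : ι → ℕ) :=
    reflTransGen_countdown_iff (n := s i) (s := s) (t := t) hfP hPi hfi rfl
  have hstar := hC.star (hC.comp (hC.pred i) hf)
  refine mem_class_congr (hC.comp hP (hC.comp hstar (hC.isZero i))) fun s t => ?_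
  constructor
  · rintro ⟨_, ⟨hPs, rfl⟩, _, hst, h0, rfl⟩
    exact ⟨hPs, (hloop _ _ hPs).1 ⟨hst, h0⟩⟩
  · rintro ⟨hPs, ht⟩
    obtain ⟨hst, h0⟩ := (hloop s t hPs).2 ht
    exact ⟨s, ⟨hPs, rfl⟩, t, hst, h0, rfl⟩

theorem move (hC : RegisterClosed C) {i j : ι} (hij : i ≠ j) (q : ℕ) :
    C (guardedMap (fun _ => True) fun s => update (update s j (s j + s i * q)) i 0) := by
  have hiter (s : ι → ℕ) (n : ℕ) :
      (fun s => update s j (s j + q))^[n] s = update s j (s j + n * q) := by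
    induction n with
    | zero => simp
    | succ n ih => rw [iterate_succ_apply', ih]; simp [add_mul, add_assoc]
  have hloop := hC.forLoop i hC.id (hC.add j q) (by simp) (by simp)
    (fun s n => by simp [update_of_ne hij.symm, update_comm hij])
  simpa only [hiter] using hloop

theorem clear (hC : RegisterClosed C) (i : ι) :
    C (guardedMap (fun _ => True) fun s => update s i 0) := by
  simpa only [iterate_id, id] using hC.forLoop i hC.id hC.id (by simp) (by simp) (by simp)

theorem mul (hC : RegisterClosed C) {i j : ι} (hij : i ≠ j) (q : ℕ) :
    C (guardedMap (fun s => s j = 0) fun s => update s i (s i * q)) := by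
  refine guardedMap_congr (hC.seq (hC.isZero j) (hC.seq (hC.move hij q) (hC.move hij.symm 1)))
    (by simp) fun s hs => ?_
  ext x
  simp only [comp_apply, id, update_apply]
  grind

/-- The contents of `i` are copied to `l` and to `j`, and then moved back from `j` to `i`. -/
theorem copy (hC : RegisterClosed C) {i j l : ι} (hij : i ≠ j) (hil : i ≠ l) (hjl : j ≠ l) :
    C (guardedMap (fun s => s j = 0) fun s => update s l (s l + s i)) := by
  have hiter (s : ι → ℕ) (n : ℕ) :
      ((fun s => update s l (s l + 1)) ∘ fun s => update s j (s j + 1))^[n] s =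
        update (update s j (s j + n)) l (s l + n) := by
    induction n with
    | zero => simp
    | succ n ih =>
      rw [iterate_succ_apply', ih]
      ext x
      grind [update_apply]
  have hloop := hC.forLoop i hC.id (guardedMap_congr (hC.seq (hC.add j 1) (hC.add l 1)) (by simp)
    fun _ _ => rfl) (by simp) (by simp) (fun s n => by ext x; grind [update_apply])
  simp only [hiter] at hloop
  refine guardedMap_congr (hC.seq (hC.isZero j) (hC.seq hloop (hC.move hij.symm 1)))
    (by simp) fun s hs => ?_
  ext x
  simp only [comp_apply, id, update_apply]
  grind

theorem notDvd (hC : RegisterClosed C) {i j : ι} (hij : i ≠ j) {p : ℕ} (hp : 0 < p) :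
    C (guardedMap (fun s => s j = 0 ∧ ¬ p ∣ s i) id) := by
  have hrem (r : ℕ) : C (guardedMap (fun s => ∃ a : ι → ℕ, a j = 0 ∧
      s = update a i (a i * p + r)) id) :=
    (guardedMap_congr (hC.reversible.seq (hC.reversible.mul hij p) (hC.reversible.add i r))
      (by simp) (by simp)).range hC.toKleeneClosed
  refine mem_class_congr (hC.iUnion_finset (Finset.Ioo 0 p) fun r _ => hrem r) fun s t => ?_
  constructor
  · rintro ⟨r, hr, ⟨a, ha, rfl⟩, rfl⟩
    rw [Finset.mem_Ioo] at hr
    refine ⟨⟨by simp [hij.symm, ha], ?_⟩, rfl⟩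
    rw [update_self, Nat.dvd_add_right (dvd_mul_left p (a i))]
    exact Nat.not_dvd_of_pos_of_lt hr.1 hr.2
  · rintro ⟨⟨hj, hd⟩, ht⟩
    refine ⟨s i % p, ?_, ⟨update s i (s i / p), by simp [hij.symm, hj], ?_⟩, ht⟩
    · rw [Finset.mem_Ioo]
      exact ⟨Nat.emod_pos_of_not_dvd hd, Nat.mod_lt _ hp⟩
    · simp [Nat.div_add_mod']

end RegisterClosed

end RegisterMachine

section ListCode

/-- The code of the list with head `x` whose tail has the code `y`. Together with `0` as the code
of the empty list, this makes every natural number the code of exactly one list. -/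
def consCode (x y : ℕ) : ℕ := 2 ^ x * (2 * y + 1)

/-- The head of the list with code `n`, and `0` for the empty list. -/
def headCode (n : ℕ) : ℕ := n.factorization 2

/-- The code of the tail of the list with code `n`. -/
def tailCode (n : ℕ) : ℕ := ordCompl[2] n / 2

theorem headCode_zero : headCode 0 = 0 := by simp [headCode]

theorem tailCode_zero : tailCode 0 = 0 := by simp [tailCode]

theorem headCode_consCode (x y : ℕ) : headCode (consCode x y) = x := by
  have hodd : ¬ 2 ∣ 2 * y + 1 := by omega
  simp [headCode, consCode, Nat.factorization_mul, Nat.prime_two.factorization_self,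
    Nat.factorization_eq_zero_of_not_dvd hodd]

theorem tailCode_consCode (x y : ℕ) : tailCode (consCode x y) = y := by
  have hodd : ¬ 2 ∣ 2 * y + 1 := by omega
  rw [tailCode, consCode, Nat.ordCompl_pow_mul_of_not_dvd x Nat.prime_two hodd]
  omega

theorem consCode_headCode_tailCode {n : ℕ} (hn : n ≠ 0) :
    consCode (headCode n) (tailCode n) = n := by
  have hodd : ¬ 2 ∣ ordCompl[2] n := Nat.not_dvd_ordCompl Nat.prime_two hn
  have htail : 2 * tailCode n + 1 = ordCompl[2] n := by unfold tailCode; omega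
  rw [consCode, htail, headCode, Nat.ordProj_mul_ordCompl_eq_self]

/-- The code of a list of natural numbers. -/
def listCode : List ℕ → ℕ
  | [] => 0
  | x :: l => consCode x (listCode l)

@[simp]
theorem headCode_listCode (l : List ℕ) : headCode (listCode l) = l.headI := by
  cases l with
  | nil => exact headCode_zero
  | cons x l => exact headCode_consCode x _

@[simp]
theorem tailCode_listCode (l : List ℕ) : tailCode (listCode l) = listCode l.tail := by
  cases l with
  | nil => exact tailCode_zero
  | cons x l => exact tailCode_consCode x _

namespace RegisterClosed

variable {ι : Type*} [DecidableEq ι] {C : ((ι → ℕ) → (ι → ℕ) → Prop) → Prop} {i j l : ι}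

/-- Since `2 ^ x * (2 * y + 1)` is `2 * y + 1` doubled `x` times, a loop moves the head onto the
list. -/
theorem push (hC : RegisterClosed C) (hij : i ≠ j) (hil : i ≠ l) (hjl : j ≠ l) :
    C (guardedMap (fun s => s l = 0)
      fun s => update (update s j (consCode (s i) (s j))) i 0) := by
  have hiter (s : ι → ℕ) (n : ℕ) :
      (fun s => update s j (s j * 2))^[n] s = update s j (2 ^ n * s j) := by
    induction n with
    | zero => simp
    | succ n ih => rw [iterate_succ_apply', ih]; simp [pow_succ, mul_right_comm]
  have hloop := hC.forLoop i (hC.isZero l) (hC.mul hjl 2) (by simp [hjl.symm])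
    (by simp [hil.symm]) (fun s n => by simp [update_of_ne hij.symm, update_comm hij])
  simp only [hiter] at hloop
  refine guardedMap_congr (hC.seq (hC.mul hjl 2) (hC.seq (hC.add j 1) hloop))
    (by simp [hjl.symm]) fun s _ => ?_
  simp [hij, consCode, mul_comm]

/-- Popping a nonempty list is the converse of pushing. -/
theorem pop (hC : RegisterClosed C) (hij : i ≠ j) (hil : i ≠ l) (hjl : j ≠ l) :
    C (guardedMap (fun s => s l = 0 ∧ s i = 0)
      fun s => update (update s j (tailCode (s j))) i (headCode (s j))) := by
  have hnil := hC.seq (hC.isZero j) (hC.seq (hC.isZero l) (hC.isZero i))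
  refine mem_class_congr (hC.union hnil (hC.reversible.push hij hil hjl).2) fun s t => ?_
  constructor
  · rintro (⟨⟨hj : s j = 0, hl, hi : s i = 0⟩, rfl⟩ | ⟨hl, rfl⟩)
    · refine ⟨⟨hl, hi⟩, ?_⟩
      ext x
      simp only [hj, headCode_zero, tailCode_zero, update_apply]
      grind
    · refine ⟨⟨by simpa [hil.symm, hjl.symm] using hl, by simp⟩, ?_⟩
      ext x
      simp only [headCode_consCode, tailCode_consCode, update_self, update_of_ne hij.symm,
        update_apply]
      grind
  · rintro ⟨⟨hl, hi⟩, rfl⟩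
    rcases eq_or_ne (s j) 0 with hj | hj
    · refine Or.inl ⟨⟨hj, hl, hi⟩, ?_⟩
      ext x
      simp only [hj, headCode_zero, tailCode_zero, comp_apply, id, update_apply]
      grind
    · refine Or.inr ⟨by simpa [hil.symm, hjl.symm] using hl, ?_⟩
      ext x
      simp only [update_self, update_of_ne hij.symm, consCode_headCode_tailCode hj, update_apply]
      grind

end RegisterClosed

end ListCode

section Goedel

variable {ι κ : Type*} [Fintype ι] {p : ι → ℕ}

/-- The Gödel number of a valuation `s` of finitely many registers, with respect to the
primes `p`. -/
def goedel (p s : ι → ℕ) : ℕ := ∏ i, p i ^ s i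

theorem dvd_goedel_iff (hp : ∀ i, (p i).Prime) (hinj : Injective p) {s : ι → ℕ} {i : ι} :
    p i ∣ goedel p s ↔ s i ≠ 0 := by
  rw [goedel, (hp i).prime.dvd_finsetProd_iff]
  constructor
  · rintro ⟨k, -, hk⟩ h0
    obtain rfl := hinj ((Nat.prime_dvd_prime_iff_eq (hp i) (hp k)).1
      ((hp i).dvd_of_dvd_pow hk))
    rw [h0, pow_zero] at hk
    exact (hp i).one_lt.ne' (Nat.dvd_one.1 hk)
  · exact fun h => ⟨i, Finset.mem_univ i, dvd_pow_self _ h⟩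

variable [DecidableEq ι]

theorem goedel_update_add_one (p s : ι → ℕ) (i : ι) :
    goedel p (update s i (s i + 1)) = goedel p s * p i := by
  simp only [goedel, ← Finset.mul_prod_erase _ _ (Finset.mem_univ i), update_self, pow_succ]
  rw [mul_right_comm]
  congr 2
  exact Finset.prod_congr rfl fun k hk => by rw [update_of_ne (Finset.ne_of_mem_erase hk)]

theorem exists_eq_update_of_goedel_eq_mul (hp : ∀ i, (p i).Prime) (hinj : Injective p)
    {s : ι → ℕ} {i : ι} {m : ℕ} (h : goedel p s = m * p i) :
    ∃ t, s = update t i (t i + 1) ∧ goedel p t = m := by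
  have hi : s i ≠ 0 := (dvd_goedel_iff hp hinj).1 (h ▸ dvd_mul_left _ _)
  have hs : s = update (update s i (s i - 1)) i (update s i (s i - 1) i + 1) := by
    simp [Nat.sub_add_cancel (Nat.pos_of_ne_zero hi)]
  refine ⟨_, hs, ?_⟩
  rw [hs, goedel_update_add_one] at h
  exact Nat.eq_of_mul_eq_mul_right (hp i).pos h

theorem single_goedel_update_add_one [DecidableEq κ] (a : κ) (p s : ι → ℕ) (i : ι) :
    (Pi.single a (goedel p (update s i (s i + 1))) : κ → ℕ) =
      update (Pi.single a (goedel p s)) a ((Pi.single a (goedel p s) : κ → ℕ) a * p i) := by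
  simp [goedel_update_add_one, Pi.single]

/-- Minsky's encoding: two counters suffice to simulate any finite number of registers. -/
theorem RegisterClosed.simulated_goedel [DecidableEq κ] {C : ((κ → ℕ) → (κ → ℕ) → Prop) → Prop}
    (hC : RegisterClosed C) {a b : κ} (hab : a ≠ b) (hp : ∀ i, (p i).Prime)
    (hinj : Injective p) :
    RegisterClosed (Simulated (fun s : ι → ℕ => Pi.single a (goedel p s)) C) where
  toKleeneClosed := hC.simulated _
  inc i := mem_class_congr (Simulated.guardedMap (Q := fun _ => True) (hC.mul hab (p i))
    (by simp [hab.symm]) fun s _ => (single_goedel_update_add_one a p s i).symm)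
      fun s t => by simp [guardedMap]
  dec i := by
    refine ⟨_, (hC.reversible.mul hab (p i)).2, fun s u => ?_⟩
    constructor
    · rintro ⟨-, hu⟩
      have hu' (x : κ) := congrFun hu x
      obtain ⟨t, ht, hta⟩ :=
        exists_eq_update_of_goedel_eq_mul hp hinj (m := u a) (by simpa using hu' a)
      refine ⟨t, ht, ?_⟩
      ext x
      rcases eq_or_ne x a with rfl | hx
      · simpa using hta
      · simpa [hx] using hu' x
    · rintro ⟨t, rfl, rfl⟩
      exact ⟨by simp [hab.symm], single_goedel_update_add_one a p t i⟩
  isZero i :=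
    Simulated.guardedMap (hC.notDvd hab (hp i).pos)
      (fun s => by simp [hab.symm, dvd_goedel_iff hp hinj]) fun s _ => rfl

end Goedel

section PartialRecursive

/-- The memory of a machine which evaluates codes of partial recursive functions: the list to which
a code is applied, and a stack of saved lists. -/
abbrev Store : Type := List ℕ × List (List ℕ)

/-- A Kleene closed class of relations between stores which contains the instructions needed to
evaluate codes of partial recursive functions. -/
structure StoreClosed (D : (Store → Store → Prop) → Prop) : Prop extends KleeneClosed D where
  consZero : D (guardedMap (fun _ => True) fun a => (0 :: a.1, a.2))
  succ : D (guardedMap (fun _ => True) fun a => ([a.1.headI + 1], a.2))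
  tail : D (guardedMap (fun _ => True) fun a => (a.1.tail, a.2))
  save : D (guardedMap (fun _ => True) fun a => (a.1, a.1 :: a.2))
  exchange : D (guardedMap (fun _ => True) fun a => (a.2.headI, a.1 :: a.2.tail))
  collect : D (guardedMap (fun _ => True) fun a => (a.2.headI.headI :: a.1, a.2.tail))
  ifZero : D (guardedMap (fun a => a.1.headI = 0) fun a => (a.1.tail, a.2))
  ifSucc : D (guardedMap (fun a => a.1.headI ≠ 0) fun a => ((a.1.headI - 1) :: a.1.tail, a.2))

/-- The registers in which a store is kept; registers `0`, `3` and `4` are for auxiliary values. -/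
def storeRegisters (a : Store) : Fin 5 → ℕ :=
  ![0, listCode a.1, listCode (a.2.map listCode), 0, 0]

theorem headI_map_listCode (L : List (List ℕ)) : (L.map listCode).headI = listCode L.headI := by
  cases L <;> rfl

section StoreRegisters

variable {C : ((Fin 5 → ℕ) → (Fin 5 → ℕ) → Prop) → Prop}

theorem RegisterClosed.push_fin (hC : RegisterClosed C) (i j : Fin 5) (hij : i ≠ j := by decide)
    (hi : i ≠ 3 := by decide) (hj : j ≠ 3 := by decide) :
    C (guardedMap (fun s => s 3 = 0) fun s => update (update s j (consCode (s i) (s j))) i 0) :=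
  hC.push hij hi hj

theorem RegisterClosed.pop_fin (hC : RegisterClosed C) (i j : Fin 5) (hij : i ≠ j := by decide)
    (hi : i ≠ 3 := by decide) (hj : j ≠ 3 := by decide) :
    C (guardedMap (fun s => s 3 = 0 ∧ s i = 0)
      fun s => update (update s j (tailCode (s j))) i (headCode (s j))) :=
  hC.pop hij hi hj

theorem RegisterClosed.simulated_storeRegisters (hC : RegisterClosed C) :
    StoreClosed (Simulated storeRegisters C) where
  toKleeneClosed := hC.simulated _
  consZero := by
    refine Simulated.guardedMap (hC.push_fin 0 1) (by simp [storeRegisters]) fun a _ => ?_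
    ext k
    fin_cases k <;> simp [storeRegisters, listCode]
  succ := by
    refine Simulated.guardedMap (hC.seq (hC.pop_fin 0 1) (hC.seq (hC.clear 1)
      (hC.seq (hC.add 0 1) (hC.push_fin 0 1)))) (by simp [storeRegisters]) fun a _ => ?_
    ext k
    fin_cases k <;> simp [storeRegisters, listCode]
  tail := by
    refine Simulated.guardedMap (hC.seq (hC.pop_fin 0 1) (hC.clear 0))
      (by simp [storeRegisters]) fun a _ => ?_
    ext k
    fin_cases k <;> simp [storeRegisters]
  save := by
    have hcopy := hC.copy (i := 1) (j := 3) (l := 0) (by decide) (by decide) (by decide)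
    refine Simulated.guardedMap (hC.seq hcopy (hC.push_fin 0 2))
      (by simp [storeRegisters]) fun a _ => ?_
    ext k
    fin_cases k <;> simp [storeRegisters, listCode]
  exchange := by
    have hmove := hC.move (i := 0) (j := 1) (by decide) 1
    refine Simulated.guardedMap (hC.seq (hC.pop_fin 0 2) (hC.seq (hC.push_fin 1 2) hmove))
      (by simp [storeRegisters]) fun a _ => ?_
    ext k
    fin_cases k <;> simp [storeRegisters, listCode, headI_map_listCode]
  collect := by
    refine Simulated.guardedMap (hC.seq (hC.pop_fin 0 2) (hC.seq (hC.pop_fin 4 0)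
      (hC.seq (hC.push_fin 4 1) (hC.clear 0)))) (by simp [storeRegisters]) fun a _ => ?_
    ext k
    fin_cases k <;> simp [storeRegisters, listCode, headI_map_listCode]
  ifZero := by
    refine Simulated.guardedMap (hC.seq (hC.pop_fin 0 1) (hC.isZero 0))
      (by simp [storeRegisters]) fun a h => ?_
    ext k
    fin_cases k <;> simp [storeRegisters, h]
  ifSucc := by
    refine Simulated.guardedMap (hC.seq (hC.pop_fin 0 1) (hC.seq (hC.pred 0) (hC.push_fin 0 1)))
      (by simp [storeRegisters]) fun a _ => ?_
    ext k
    fin_cases k <;> simp [storeRegisters, listCode]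

end StoreRegisters

theorem mem_fix_iff_reflTransGen {α β : Type*} {f : α →. β ⊕ α} {a : α} {b : β} :
    b ∈ f.fix a ↔ ∃ c, ReflTransGen (fun x y => Sum.inr y ∈ f x) a c ∧ Sum.inl b ∈ f c := by
  constructor
  · intro h
    refine PFun.fixInduction' (C := fun a => ∃ c, ReflTransGen _ a c ∧ Sum.inl b ∈ f c) h
      (fun a ha => ⟨a, .refl, ha⟩) fun a a' _ ha ih => ?_
    exact ih.imp fun c hc => ⟨hc.1.head ha, hc.2⟩
  · rintro ⟨c, hac, hc⟩
    induction hac using ReflTransGen.head_induction_on with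
    | refl => exact PFun.fix_stop hc
    | head h _ ih => exact PFun.mem_fix_iff.2 (.inr ⟨_, h, ih⟩)

/-- Evaluation of the code `c` as a relation between stores, which leaves the stack unchanged. -/
def evalRel (c : ToPartrec.Code) (a b : Store) : Prop := b.1 ∈ c.eval a.1 ∧ b.2 = a.2

namespace StoreClosed

variable {D : (Store → Store → Prop) → Prop} {f g : ToPartrec.Code}

theorem evalRel_cons (hD : StoreClosed D) (hf : D (evalRel f)) (hg : D (evalRel g)) :
    D (evalRel (f.cons g)) := by
  refine mem_class_congr (hD.comp hD.save (hD.comp hf (hD.comp hD.exchange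
    (hD.comp hg hD.collect)))) fun a b => ?_
  obtain ⟨u, S⟩ := a
  obtain ⟨v, T⟩ := b
  simp [Comp, guardedMap, evalRel, ← exists_and_right, and_assoc]

theorem evalRel_comp (hD : StoreClosed D) (hf : D (evalRel f)) (hg : D (evalRel g)) :
    D (evalRel (f.comp g)) := by
  refine mem_class_congr (hD.comp hg hf) fun a b => ?_
  have hbind : b.1 ∈ (f.comp g).eval a.1 ↔ ∃ v ∈ g.eval a.1, b.1 ∈ f.eval v :=
    ToPartrec.Code.comp_eval f g ▸ Part.mem_bind_iff
  simp [Comp, evalRel, hbind, ← exists_and_right, and_assoc, -ToPartrec.Code.comp_eval]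

theorem evalRel_case (hD : StoreClosed D) (hf : D (evalRel f)) (hg : D (evalRel g)) :
    D (evalRel (f.case g)) := by
  refine mem_class_congr (hD.union (hD.comp hD.ifZero hf) (hD.comp hD.ifSucc hg)) fun a b => ?_
  rcases h : a.1.headI with - | n <;> simp [Comp, guardedMap, evalRel, h]

theorem evalRel_fix (hD : StoreClosed D) (hf : D (evalRel f)) : D (evalRel f.fix) := by
  let step (u : List ℕ) : Part (List ℕ ⊕ List ℕ) :=
    (f.eval u).map fun v => if v.headI = 0 then Sum.inl v.tail else Sum.inr v.tail
  have hhalt : D fun a b => Sum.inl b.1 ∈ step a.1 ∧ b.2 = a.2 := by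
    refine mem_class_congr (hD.comp hf hD.ifZero) fun a b => ?_
    simp [step, Part.mem_map_iff, ite_eq_iff, Comp, guardedMap, evalRel, Prod.ext_iff,
      @eq_comm _ b.1, ← exists_and_right, and_assoc]
  have hnext : D fun a b => Sum.inr b.1 ∈ step a.1 ∧ b.2 = a.2 := by
    refine mem_class_congr (hD.comp hf (hD.seq hD.ifSucc hD.tail)) fun a b => ?_
    simp [step, Part.mem_map_iff, ite_eq_iff, Comp, guardedMap, evalRel, Prod.ext_iff,
      @eq_comm _ b.1, ← exists_and_right, and_assoc]
  refine mem_class_congr (hD.comp (hD.star hnext) hhalt) fun a b => ?_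
  have hfix : b.1 ∈ f.fix.eval a.1 ↔ _ :=
    ToPartrec.Code.fix_eval f ▸ mem_fix_iff_reflTransGen
  rw [evalRel, hfix]
  constructor
  · rintro ⟨c, hac, hcb, hb⟩
    refine ⟨⟨c.1, hac.lift Prod.fst fun _ _ h => h.1, hcb⟩, hb.trans ?_⟩
    clear hcb hb
    induction hac with
    | refl => rfl
    | tail _ h ih => exact h.2.trans ih
  · rintro ⟨⟨u, hu, hub⟩, hb⟩
    exact ⟨(u, a.2), hu.lift (·, a.2) fun _ _ h => ⟨h, rfl⟩, hub, hb⟩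

theorem evalRel_code (hD : StoreClosed D) (c : ToPartrec.Code) : D (evalRel c) := by
  induction c with
  | zero' => exact mem_class_congr hD.consZero (by simp [evalRel, guardedMap, Prod.ext_iff])
  | succ => exact mem_class_congr hD.succ (by simp [evalRel, guardedMap, Prod.ext_iff])
  | tail => exact mem_class_congr hD.tail (by simp [evalRel, guardedMap, Prod.ext_iff])
  | cons f g hf hg => exact hD.evalRel_cons hf hg
  | comp f g hf hg => exact hD.evalRel_comp hf hg
  | case f g hf hg => exact hD.evalRel_case hf hg
  | fix f hf => exact hD.evalRel_fix hf

end StoreClosed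

/-- The registers are numbered by the first primes, so that a store which holds only the list `[n]`
becomes the Gödel number `3 ^ 2 ^ n`. -/
theorem RegisterClosed.exists_simulates_partrec {κ : Type*} [DecidableEq κ]
    {C : ((κ → ℕ) → (κ → ℕ) → Prop) → Prop} (hC : RegisterClosed C) {a b : κ} (hab : a ≠ b)
    {f : ℕ →. ℕ} (hf : Partrec f) :
    ∃ R, C R ∧ ∀ n, (f n).Dom ↔ ∃ t, R (Pi.single a (3 ^ 2 ^ n)) t := by
  have hprime : ∀ i, ((![2, 3, 5, 7, 11] : Fin 5 → ℕ) i).Prime := by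
    simp [Fin.forall_fin_succ]; norm_num
  have hinj : Injective (![2, 3, 5, 7, 11] : Fin 5 → ℕ) := by decide
  obtain ⟨c, hc⟩ := ToPartrec.Code.exists_code (Nat.Partrec'.part_iff₁.2 hf)
  obtain ⟨R, ⟨R₀, hR₀, hR⟩, hc'⟩ :=
    (hC.simulated_goedel hab hprime hinj).simulated_storeRegisters.evalRel_code c
  refine ⟨R₀, hR₀, fun n => ?_⟩
  have hcode : c.eval [n] = (f n).map pure := hc ⟨[n], rfl⟩
  have hinput : goedel ![2, 3, 5, 7, 11] (storeRegisters ([n], [])) = 3 ^ 2 ^ n := by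
    simp [goedel, storeRegisters, Fin.prod_univ_succ, listCode, consCode]
  calc (f n).Dom ↔ ∃ b, evalRel c ([n], []) b := by
        simp [evalRel, hcode, Part.dom_iff_mem]
    _ ↔ ∃ s, R (storeRegisters ([n], [])) s := by simp [hc']
    _ ↔ ∃ t, R₀ (Pi.single a (3 ^ 2 ^ n)) t := by simp [← hinput, hR]

end PartialRecursive

section Regular

variable {α : Type*}

/-- A variant of the Myhill–Nerode criterion: the left quotients of `L` are unions of members of
`F`. -/
theorem isRegularLanguage_of_append_mem_iff {L : Language α} {F : Set (Language α)}
    (hF : F.Finite) (P : List α → Language α → Prop)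
    (h : ∀ x y, x ++ y ∈ L ↔ ∃ A ∈ F, P x A ∧ y ∈ A) : L.IsRegular := by
  refine .of_finite_range_leftQuotient ((hF.powerset.image
    fun T : Set (Language α) => ({y | ∃ A ∈ T, y ∈ A} : Language α)).subset ?_)
  rintro _ ⟨x, rfl⟩
  refine ⟨{A ∈ F | P x A}, fun A hA => hA.1, ?_⟩
  ext y
  refine Iff.trans ?_ (h x y).symm
  exact ⟨fun ⟨A, ⟨hA, hP⟩, hy⟩ => ⟨A, hA, hP, hy⟩, fun ⟨A, hA, hP, hy⟩ => ⟨A, ⟨hA, hP⟩, hy⟩⟩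

theorem isRegularLanguage_zero : (0 : Language α).IsRegular :=
  isRegularLanguage_of_append_mem_iff Set.finite_empty (fun _ _ => True) (by simp)

theorem isRegularLanguage_one : (1 : Language α).IsRegular :=
  isRegularLanguage_of_append_mem_iff (Set.finite_singleton 1) (fun x _ => x = [])
    (by simp [Language.mem_one])

theorem isRegularLanguage_singleton (a : α) : ({[a]} : Language α).IsRegular := by
  refine isRegularLanguage_of_append_mem_iff (F := {{[a]}, 1}) (by simp)
    (fun x A => x = [] ∧ A = {[a]} ∨ x = [a] ∧ A = 1) fun x y => ?_
  change x ++ y = [a] ↔ _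
  rw [List.append_eq_singleton_iff]
  constructor
  · rintro (⟨rfl, rfl⟩ | ⟨rfl, rfl⟩)
    · exact ⟨{[a]}, by simp, by simp, rfl⟩
    · exact ⟨1, by simp, by simp, rfl⟩
  · rintro ⟨A, -, (⟨rfl, rfl⟩ | ⟨rfl, rfl⟩), hy⟩
    · exact Or.inl ⟨rfl, hy⟩
    · exact Or.inr ⟨rfl, hy⟩

theorem isRegularLanguage_mul {L M : Language α} (hL : L.IsRegular) (hM : M.IsRegular) :
    (L * M).IsRegular := by
  refine isRegularLanguage_of_append_mem_iff
    ((hL.finite_range_leftQuotient.image (· * M)).union hM.finite_range_leftQuotient)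
    (fun x A => A = L.leftQuotient x * M ∨
      ∃ u v, x = u ++ v ∧ u ∈ L ∧ A = M.leftQuotient v) fun x y => ?_
  constructor
  · rintro ⟨l, hl, m, hm, h⟩
    rcases List.append_eq_append_iff.1 h.symm with ⟨l', rfl, rfl⟩ | ⟨v, rfl, rfl⟩
    · exact ⟨_, Or.inl ⟨_, ⟨x, rfl⟩, rfl⟩, Or.inl rfl, l', hl, m, hm, rfl⟩
    · exact ⟨_, Or.inr ⟨v, rfl⟩, Or.inr ⟨l, v, rfl, hl, rfl⟩, hm⟩
  · rintro ⟨A, -, rfl | ⟨u, v, rfl, hu, rfl⟩, hy⟩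
    · obtain ⟨l', hl', m, hm, rfl⟩ := hy
      exact ⟨x ++ l', hl', m, hm, by simp⟩
    · exact ⟨u, hu, v ++ y, hy, by simp⟩

section Kstar

open scoped Computability

theorem append_mem_kstar {L : Language α} {u v : List α} (hu : u ∈ L∗) (hv : v ∈ L∗) :
    u ++ v ∈ L∗ :=
  kstar_mul_kstar L ▸ Language.append_mem_mul hu hv

theorem mem_kstar_of_mem {L : Language α} {w : List α} (hw : w ∈ L) : w ∈ L∗ :=
  (le_kstar : L ≤ L∗) hw

theorem append_mem_kstar_iff {L : Language α} {x y : List α} :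
    x ++ y ∈ L∗ ↔ x ∈ L∗ ∧ y ∈ L∗ ∨
      ∃ u v, x = u ++ v ∧ u ∈ L∗ ∧ y ∈ L.leftQuotient v * L∗ := by
  constructor
  · rintro ⟨ws, h, hws⟩
    induction ws generalizing x with
    | nil =>
      obtain ⟨rfl, rfl⟩ := List.append_eq_nil_iff.1 h
      exact Or.inl ⟨Language.nil_mem_kstar L, Language.nil_mem_kstar L⟩
    | cons w ws ih =>
      have ⟨hw, hws'⟩ := List.forall_mem_cons.1 hws
      rw [List.flatten_cons] at h
      rcases List.append_eq_append_iff.1 h with ⟨y₁, rfl, rfl⟩ | ⟨x', rfl, h'⟩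
      · exact Or.inr ⟨[], x, rfl, Language.nil_mem_kstar L, y₁, hw, _, ⟨ws, rfl, hws'⟩, rfl⟩
      · rcases ih h'.symm hws' with ⟨hx, hy⟩ | ⟨u, v, rfl, hu, hy⟩
        · exact Or.inl ⟨append_mem_kstar (mem_kstar_of_mem hw) hx, hy⟩
        · exact Or.inr ⟨w ++ u, v, by simp, append_mem_kstar (mem_kstar_of_mem hw) hu, hy⟩
  · rintro (⟨hx, hy⟩ | ⟨u, v, rfl, hu, y₁, hy₁, y₂, hy₂, rfl⟩)
    · exact append_mem_kstar hx hy
    · have hmid := mem_kstar_of_mem ((L.mem_leftQuotient v y₁).1 hy₁)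
      simpa using append_mem_kstar hu (append_mem_kstar hmid hy₂)

theorem isRegularLanguage_kstar {L : Language α} (hL : L.IsRegular) : (L∗).IsRegular := by
  refine isRegularLanguage_of_append_mem_iff
    ((hL.finite_range_leftQuotient.image (· * L∗)).insert (L∗))
    (fun x A => A = L∗ ∧ x ∈ L∗ ∨
      ∃ u v, x = u ++ v ∧ u ∈ L∗ ∧ A = L.leftQuotient v * L∗) fun x y => ?_
  rw [append_mem_kstar_iff]
  constructor
  · rintro (⟨hx, hy⟩ | ⟨u, v, hx, hu, hy⟩)
    · exact ⟨L∗, Or.inl rfl, Or.inl ⟨rfl, hx⟩, hy⟩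
    · exact ⟨_, Or.inr ⟨_, ⟨v, rfl⟩, rfl⟩, Or.inr ⟨u, v, hx, hu, rfl⟩, hy⟩
  · rintro ⟨A, -, ⟨rfl, hx⟩ | ⟨u, v, hx, hu, rfl⟩, hy⟩
    · exact Or.inl ⟨hx, hy⟩
    · exact Or.inr ⟨u, v, hx, hu, hy⟩

end Kstar

end Regular

section Executes

variable {α T : Type*}

/-- The paths of a labelled transition system: the word `w` is the sequence of labels of a path
from `c` to `d`. -/
def Executes (step : α → T → T → Prop) : T → List α → T → Prop
  | c, [], d => d = c
  | c, a :: w, d => ∃ e, step a c e ∧ Executes step e w d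

theorem executes_append {step : α → T → T → Prop} {c d : T} {u v : List α} :
    Executes step c (u ++ v) d ↔ ∃ e, Executes step c u e ∧ Executes step e v d := by
  induction u generalizing c with
  | nil => simp [Executes]
  | cons a u ih =>
    simp only [List.cons_append, Executes, ih]
    constructor
    · rintro ⟨e, he, f, hf, hd⟩
      exact ⟨f, ⟨e, he, hf⟩, hd⟩
    · rintro ⟨f, ⟨e, he, hf⟩, hd⟩
      exact ⟨e, he, f, hf, hd⟩

theorem Executes.mono {step step' : α → T → T → Prop}
    (hstep : ∀ a c d, step a c d → step' a c d) {c d : T} {w : List α}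
    (h : Executes step c w d) : Executes step' c w d := by
  induction w generalizing c with
  | nil => exact h
  | cons a w ih =>
    obtain ⟨e, he, h⟩ := h
    exact ⟨e, hstep a c e he, ih h⟩

/-- The relations which relate the ends of the paths labelled by the words of some regular
language. -/
def IsRegularRel (step : α → T → T → Prop) (R : T → T → Prop) : Prop :=
  ∃ L : Language α, L.IsRegular ∧ ∀ c d, R c d ↔ ∃ w ∈ L, Executes step c w d

theorem isRegularRel_step (step : α → T → T → Prop) (a : α) : IsRegularRel step (step a) := by
  refine ⟨{[a]}, isRegularLanguage_singleton a, fun c d => ?_⟩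
  constructor
  · exact fun h => ⟨[a], rfl, d, h, rfl⟩
  · rintro ⟨_, rfl, e, h, rfl⟩
    exact h

theorem exists_mem_mul_executes_iff {step : α → T → T → Prop} {L M : Language α} {c d : T} :
    (∃ w ∈ L * M, Executes step c w d) ↔
      Comp (fun c d => ∃ w ∈ L, Executes step c w d) (fun c d => ∃ w ∈ M, Executes step c w d)
        c d := by
  constructor
  · rintro ⟨_, ⟨u, hu, v, hv, rfl⟩, h⟩
    obtain ⟨e, hu', hv'⟩ := executes_append.1 h
    exact ⟨e, ⟨u, hu, hu'⟩, v, hv, hv'⟩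
  · rintro ⟨e, ⟨u, hu, hu'⟩, v, hv, hv'⟩
    exact ⟨u ++ v, Language.append_mem_mul hu hv, executes_append.2 ⟨e, hu', hv'⟩⟩

open scoped Computability in
theorem exists_mem_kstar_executes_iff {step : α → T → T → Prop} {L : Language α} {c d : T} :
    (∃ w ∈ L∗, Executes step c w d) ↔
      ReflTransGen (fun c d => ∃ w ∈ L, Executes step c w d) c d := by
  constructor
  · rintro ⟨_, ⟨ws, rfl, hws⟩, h⟩
    induction ws generalizing c with
    | nil => obtain rfl : d = c := h; exact .refl
    | cons w ws ih =>
      rw [List.flatten_cons, executes_append] at h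
      obtain ⟨e, hw, hd⟩ := h
      exact .head ⟨w, hws w (by simp), hw⟩ (ih (fun y hy => hws y (by simp [hy])) hd)
  · intro h
    induction h with
    | refl => exact ⟨[], Language.nil_mem_kstar L, rfl⟩
    | tail _ h ih =>
      obtain ⟨u, hu, hu'⟩ := ih
      obtain ⟨v, hv, hv'⟩ := h
      exact ⟨u ++ v, append_mem_kstar hu (mem_kstar_of_mem hv), executes_append.2 ⟨_, hu', hv'⟩⟩

theorem kleeneClosed_isRegularRel (step : α → T → T → Prop) :
    KleeneClosed (IsRegularRel step) where
  one := ⟨1, isRegularLanguage_one, fun c d => by simp [Language.mem_one, Executes]⟩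
  zero := ⟨0, isRegularLanguage_zero, fun c d => by simp⟩
  comp := by
    rintro R S ⟨L, hL, hR⟩ ⟨M, hM, hS⟩
    exact ⟨L * M, isRegularLanguage_mul hL hM, fun c d => by
      simp only [exists_mem_mul_executes_iff, Comp, hR, hS]⟩
  union := by
    rintro R S ⟨L, hL, hR⟩ ⟨M, hM, hS⟩
    refine ⟨L + M, hL.add hM, fun c d => ?_⟩
    simp only [hR, hS, ← exists_or, Language.mem_add, or_and_right]
  star := by
    rintro R ⟨L, hL, hR⟩
    refine ⟨KStar.kstar L, isRegularLanguage_kstar hL, fun c d => ?_⟩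
    rw [exists_mem_kstar_executes_iff]
    simp only [← hR]

end Executes

/-- The operations of a machine with `k` counters. -/
inductive CounterOp (k : ℕ)
  | inc (i : Fin k)
  | dec (i : Fin k)
  | isZero (i : Fin k)
  deriving Fintype

namespace CounterOp

variable {k : ℕ}

/-- The change of the counters by an operation. -/
def effect : CounterOp k → Fin k → ℤ
  | inc i => Pi.single i 1
  | dec i => -Pi.single i 1
  | isZero _ => 0

/-- The counters which an operation tests for zero. -/
def tested : CounterOp k → Finset (Fin k)
  | isZero i => {i}
  | _ => ∅

end CounterOp

section CounterStep

variable {k : ℕ} {α : Type*}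

/-- The counters change by the effect of the letter `a`; zero tests are ignored. -/
def WeakStep (eff : α → Fin k → ℤ) (a : α) (c d : Fin k → ℕ) : Prop :=
  ∀ i, (d i : ℤ) = c i + eff a i

/-- The counters change by the effect of the letter `a`, and its zero tests succeed. -/
def StrictStep (eff : α → Fin k → ℤ) (test : α → Finset (Fin k)) (a : α)
    (c d : Fin k → ℕ) : Prop :=
  WeakStep eff a c d ∧ ∀ i ∈ test a, c i = 0

theorem WeakStep.unique {eff : α → Fin k → ℤ} {a : α} {c d e : Fin k → ℕ}
    (hd : WeakStep eff a c d) (he : WeakStep eff a c e) : d = e :=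
  funext fun i => Nat.cast_injective ((hd i).trans (he i).symm)

theorem forall_eq_add_single_iff {i : Fin k} {s t : Fin k → ℕ} :
    (∀ j, (t j : ℤ) = s j + (Pi.single i 1 : Fin k → ℤ) j) ↔ t = update s i (s i + 1) := by
  rw [funext_iff]
  refine forall_congr' fun j => ?_
  rcases eq_or_ne j i with rfl | hj
  · simp only [Pi.single_eq_same, update_self]
    omega
  · simp [hj]

theorem forall_eq_add_neg_single_iff {i : Fin k} {s t : Fin k → ℕ} :
    (∀ j, (t j : ℤ) = s j + (-Pi.single i 1 : Fin k → ℤ) j) ↔ s = update t i (t i + 1) := by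
  rw [← forall_eq_add_single_iff]
  refine forall_congr' fun j => ?_
  rw [Pi.neg_apply, ← sub_eq_add_neg, eq_sub_iff_add_eq, eq_comm]

theorem registerClosed_strictStep {op : α → CounterOp k} (hop : Surjective op) :
    RegisterClosed (IsRegularRel (StrictStep (fun a => (op a).effect)
      fun a => (op a).tested)) where
  toKleeneClosed := kleeneClosed_isRegularRel _
  inc i := by
    obtain ⟨a, ha⟩ := hop (.inc i)
    refine mem_class_congr (isRegularRel_step _ a) fun s t => ?_
    simp [StrictStep, WeakStep, ha, CounterOp.effect, CounterOp.tested, forall_eq_add_single_iff]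
  dec i := by
    obtain ⟨a, ha⟩ := hop (.dec i)
    refine mem_class_congr (isRegularRel_step _ a) fun s t => ?_
    rw [← forall_eq_add_neg_single_iff]
    simp [StrictStep, WeakStep, ha, CounterOp.effect, CounterOp.tested]
  isZero i := by
    obtain ⟨a, ha⟩ := hop (.isZero i)
    refine mem_class_congr (isRegularRel_step _ a) fun s t => ?_
    simp [StrictStep, WeakStep, guardedMap, ha, CounterOp.effect, CounterOp.tested, funext_iff,
      and_comm]

end CounterStep

namespace VASS

variable {k : ℕ} {α Q : Type}

/-- One step of the configuration graph of `V`, labelled by the letter which is read. -/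
def Step (V : VASS k α Q) (a : α) (x y : Q × (Fin k → ℕ)) : Prop :=
  ∃ t ∈ V.trans, t.letter = a ∧ Fires t x y

theorem executes_step_iff {V : VASS k α Q} {w : List α} {x y : Q × (Fin k → ℕ)} :
    Executes V.Step x w y ↔ ∃ ρ, ρ.map VASSTransition.letter = w ∧ V.IsRun x ρ y := by
  induction w generalizing x with
  | nil => simp [Executes, IsRun, @eq_comm _ y]
  | cons a w ih =>
    simp only [Executes, Step, ih]
    constructor
    · rintro ⟨e, ⟨t, ht, rfl, he⟩, ρ, rfl, hρ⟩
      exact ⟨t :: ρ, rfl, ht, e, he, hρ⟩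
    · rintro ⟨ρ, hw, hρ⟩
      obtain ⟨t, ρ, rfl, rfl, rfl⟩ := List.map_eq_cons_iff.1 hw
      obtain ⟨ht, e, he, hρ⟩ := hρ
      exact ⟨e, ⟨t, ht, rfl, he⟩, ρ, rfl, hρ⟩

theorem mem_language_iff {V : VASS k α Q} {w : List α} :
    w ∈ V.language ↔ ∃ x, Executes V.Step V.init w x ∧ V.IsAccepting x := by
  simp only [executes_step_iff, ← exists_and_right, and_assoc]
  exact ⟨fun ⟨ρ, hw, x, h⟩ => ⟨x, ρ, hw, h⟩, fun ⟨x, ρ, hw, h⟩ => ⟨ρ, hw, x, h⟩⟩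

/-- `V` is deterministic: a state and a letter determine at most one transition. -/
def Deterministic (V : VASS k α Q) : Prop :=
  ∀ t ∈ V.trans, ∀ t' ∈ V.trans, t.src = t'.src → t.letter = t'.letter → t = t'

theorem Fires.unique {t : VASSTransition k α Q} {x y z : Q × (Fin k → ℕ)} (hy : Fires t x y)
    (hz : Fires t x z) : y = z :=
  Prod.ext (hy.2.1.trans hz.2.1.symm)
    (funext fun i => Nat.cast_injective ((hy.2.2 i).trans (hz.2.2 i).symm))

theorem Deterministic.isRun_unique {V : VASS k α Q} (hV : V.Deterministic)
    {ρ ρ' : List (VASSTransition k α Q)} {x y y' : Q × (Fin k → ℕ)} (h : V.IsRun x ρ y)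
    (h' : V.IsRun x ρ' y') (hρ : ρ.map VASSTransition.letter = ρ'.map VASSTransition.letter) :
    ρ = ρ' := by
  induction ρ generalizing x ρ' with
  | nil => exact (List.map_eq_nil_iff.1 hρ.symm).symm
  | cons t ρ ih =>
    obtain ⟨t', ρ', rfl, hl, hρ'⟩ := List.map_eq_cons_iff.1 hρ.symm
    obtain ⟨ht, e, he, h⟩ := h
    obtain ⟨ht', e', he', h'⟩ := h'
    obtain rfl := hV t ht t' ht' (he.1.symm.trans he'.1) hl.symm
    obtain rfl := he.unique he'
    rw [ih h h' hρ'.symm]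

theorem Deterministic.unambiguous {V : VASS k α Q} (hV : V.Deterministic) : V.Unambiguous := by
  rintro w ⟨ρ, hρ⟩
  refine ⟨ρ, hρ, fun ρ' hρ' => ?_⟩
  obtain ⟨hw, y, hy, -⟩ := hρ
  obtain ⟨hw', y', hy', -⟩ := hρ'
  exact hV.isRun_unique hy' hy (hw'.trans hw.symm)

section OfDFA

variable [Fintype α] [Fintype Q]

open scoped Classical in
/-- The VASS which follows a deterministic finite automaton and executes its input as counter
operations, ignoring zero tests. -/
noncomputable def ofDFA (M : DFA α Q) (eff : α → Fin k → ℤ) (c : Fin k → ℕ) : VASS k α Q where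
  init := (M.start, c)
  final := M.accept.toFinset.image fun q => (q, 0)
  trans := Finset.univ.image fun x : Q × α => ⟨x.1, x.2, eff x.2, M.step x.1 x.2⟩

variable {M : DFA α Q} {eff : α → Fin k → ℤ} {c : Fin k → ℕ}

theorem deterministic_ofDFA : (ofDFA M eff c).Deterministic := by
  simp only [Deterministic, ofDFA, Finset.mem_image, Finset.mem_univ, true_and]
  rintro _ ⟨_, rfl⟩ _ ⟨_, rfl⟩ hsrc hletter
  simp_all

theorem step_ofDFA {a : α} {x y : Q × (Fin k → ℕ)} :
    (ofDFA M eff c).Step a x y ↔ y.1 = M.step x.1 a ∧ WeakStep eff a x.2 y.2 := by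
  simp [Step, Fires, ofDFA, WeakStep]

theorem executes_ofDFA {w : List α} {x y : Q × (Fin k → ℕ)} :
    Executes (ofDFA M eff c).Step x w y ↔
      y.1 = M.evalFrom x.1 w ∧ Executes (WeakStep eff) x.2 w y.2 := by
  induction w generalizing x with
  | nil => simp [Executes, Prod.ext_iff]
  | cons a w ih =>
    simp only [Executes, step_ofDFA, ih]
    exact ⟨fun ⟨e, ⟨he, hstep⟩, hy, hw⟩ =>
        ⟨hy.trans (by rw [he, DFA.evalFrom_cons]), e.2, hstep, hw⟩,
      fun ⟨hy, d, hstep, hw⟩ => ⟨(M.step x.1 a, d), ⟨rfl, hstep⟩, hy, hw⟩⟩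

theorem mem_language_ofDFA {w : List α} :
    w ∈ (ofDFA M eff c).language ↔ w ∈ M.accepts ∧ ∃ d, Executes (WeakStep eff) c w d := by
  have hinit : (ofDFA M eff c).init = (M.start, c) := rfl
  have haccepting (x) : (ofDFA M eff c).IsAccepting x ↔ x.1 ∈ M.accept := by
    simp [IsAccepting, ofDFA]
  simp [mem_language_iff, executes_ofDFA, hinit, haccepting, DFA.mem_accepts, DFA.eval, and_comm]

end OfDFA

section Cheats

variable [Fintype α]

open scoped Classical in
/-- The VASS which accepts the sequences of counter operations in which some test for zero of a
nonzero counter occurs: it guesses the test, and decrements the counter to check that it is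
nonzero. -/
noncomputable def cheats (eff : α → Fin k → ℤ) (test : α → Finset (Fin k))
    (c : Fin k → ℕ) : VASS k α (Fin 2) where
  init := (0, c)
  final := {(1, 0)}
  trans := (Finset.univ.image fun a => ⟨0, a, eff a, 0⟩) ∪
    (Finset.univ.image fun a => ⟨1, a, 0, 1⟩) ∪
    Finset.univ.biUnion fun a => (test a).image fun i => ⟨0, a, -Pi.single i 1, 1⟩

variable {eff : α → Fin k → ℤ} {test : α → Finset (Fin k)} {c₀ : Fin k → ℕ}

theorem step_cheats {a : α} {x y : Fin 2 × (Fin k → ℕ)} :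
    (cheats eff test c₀).Step a x y ↔ x.1 = 0 ∧ y.1 = 0 ∧ WeakStep eff a x.2 y.2 ∨
      x.1 = 1 ∧ y.1 = 1 ∧ y.2 = x.2 ∨
      ∃ i ∈ test a, x.1 = 0 ∧ y.1 = 1 ∧ x.2 = update y.2 i (y.2 i + 1) := by
  simp only [← forall_eq_add_neg_single_iff]
  simp [Step, Fires, cheats, WeakStep, or_and_right, exists_or, funext_iff]

theorem executes_cheats_one (c : Fin k → ℕ) (w : List α) :
    Executes (cheats eff test c₀).Step (1, c) w (1, c) := by
  induction w with
  | nil => rfl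
  | cons a w ih => exact ⟨(1, c), step_cheats.2 (.inr (.inl ⟨rfl, rfl, rfl⟩)), ih⟩

theorem exists_executes_cheats_iff {w : List α} {c d : Fin k → ℕ}
    (h : Executes (WeakStep eff) c w d) :
    (∃ e, Executes (cheats eff test c₀).Step (0, c) w (1, e)) ↔
      ¬ ∃ e, Executes (StrictStep eff test) c w e := by
  induction w generalizing c with
  | nil => simp [Executes]
  | cons a w ih =>
    obtain ⟨b, hb, h⟩ := h
    by_cases hz : ∀ i ∈ test a, c i = 0
    · have hstep (x) : (cheats eff test c₀).Step a (0, c) x ↔ x = (0, b) := by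
        rw [step_cheats]
        constructor
        · rintro (⟨-, hx, hbx⟩ | ⟨h, -⟩ | ⟨i, hi, -, -, hcx⟩)
          · exact Prod.ext hx (hbx.unique hb)
          · exact absurd h zero_ne_one
          · exact absurd ((congrFun hcx i).symm.trans (hz i hi)) (by simp)
        · rintro rfl
          exact .inl ⟨rfl, rfl, hb⟩
      have hstrict (x) : StrictStep eff test a c x ↔ x = b :=
        ⟨fun h => h.1.unique hb, fun h => h ▸ ⟨hb, hz⟩⟩
      simpa only [Executes, hstep, hstrict, exists_eq_left] using ih h
    · have hstrict (x) : ¬ StrictStep eff test a c x := fun h => hz h.2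
      push Not at hz
      obtain ⟨i, hi, hci⟩ := hz
      have hstep : (cheats eff test c₀).Step a (0, c) (1, update c i (c i - 1)) :=
        step_cheats.2 (.inr (.inr ⟨i, hi, rfl, rfl, by
          simp [Nat.sub_add_cancel (Nat.pos_of_ne_zero hci)]⟩))
      simp only [Executes, hstrict, false_and, exists_false, not_false_iff, iff_true]
      exact ⟨_, _, hstep, executes_cheats_one _ w⟩

theorem mem_language_cheats_iff {w : List α} {c d : Fin k → ℕ}
    (h : Executes (WeakStep eff) c w d) :
    w ∈ (cheats eff test c).language ↔ ¬ ∃ e, Executes (StrictStep eff test) c w e := by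
  rw [← exists_executes_cheats_iff (c₀ := c) h]
  have hinit : (cheats eff test c).init = (0, c) := rfl
  have haccepting (x) : (cheats eff test c).IsAccepting x ↔ x.1 = 1 := by
    simp [IsAccepting, cheats]
  simp [mem_language_iff, hinit, haccepting]

end Cheats

theorem language_ofDFA_le_cheats_iff [Fintype α] [Fintype Q] {M : DFA α Q}
    {eff : α → Fin k → ℤ} {test : α → Finset (Fin k)} {c : Fin k → ℕ} :
    (ofDFA M eff c).language ≤ (cheats eff test c).language ↔
      ¬ ∃ w ∈ M.accepts, ∃ d, Executes (StrictStep eff test) c w d := by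
  constructor
  · rintro hle ⟨w, hw, d, hd⟩
    have hweak : Executes (WeakStep eff) c w d := hd.mono fun _ _ _ h => h.1
    exact (mem_language_cheats_iff hweak).1 (hle (mem_language_ofDFA.2 ⟨hw, d, hweak⟩)) ⟨d, hd⟩
  · rintro hn w hw
    obtain ⟨hw, d, hd⟩ := mem_language_ofDFA.1 hw
    exact (mem_language_cheats_iff hd).2 fun he => hn ⟨w, hw, he⟩

section ToCode

variable {m n : ℕ}

/-- The description of a VASS which lists its final configurations and its transitions in some
order, each of them once. -/
noncomputable def toCode (V : VASS k (Fin m) (Fin n)) : Code k :=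
  ((m, n), ((V.init.1 : ℕ), V.init.2), V.final.toList.map fun f => ((f.1 : ℕ), f.2),
    V.trans.toList.map fun t => ((t.src : ℕ), (t.letter : ℕ), t.eff, (t.tgt : ℕ)))

theorem isCode_toCode (V : VASS k (Fin m) (Fin n)) : V.IsCode V.toCode where
  sizes := rfl
  init := rfl
  final x := by simp [toCode, eq_comm]
  trans x := by simp [toCode, eq_comm]

theorem computable_toCode_init {β : Type*} [Primcodable β] (V : VASS k (Fin m) (Fin n))
    {f : β → Fin n × (Fin k → ℕ)} (hf : Computable f) :
    Computable fun x => toCode { V with init := f x } :=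
  (Computable.const _).pair <| .pair
    ((Primrec.fin_val.to_comp.comp (Computable.fst.comp hf)).pair (Computable.snd.comp hf))
    (Computable.const (V.toCode.2.2))

end ToCode

end VASS

section Undecidability

theorem exists_partrec_not_computablePred_dom :
    ∃ f : ℕ →. ℕ, Partrec f ∧ ¬ ComputablePred fun n => (f n).Dom := by
  refine ⟨fun n => (Denumerable.ofNat Nat.Partrec.Code n).eval 0,
    Nat.Partrec.Code.eval_part.comp (Computable.ofNat _) (Computable.const 0), fun h => ?_⟩
  obtain ⟨g, hg, hdom⟩ := ComputablePred.computable_iff.1 h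
  refine ComputablePred.halting_problem 0 (ComputablePred.computable_iff.2
    ⟨fun c => g (Encodable.encode c), hg.comp Computable.encode, funext fun c => ?_⟩)
  simpa only [Denumerable.ofNat_encode] using congrFun hdom (Encodable.encode c)

theorem primrec_pi_single {k : ℕ} {β : Type*} [Primcodable β] (i : Fin k) {g : β → ℕ}
    (hg : Primrec g) : Primrec fun x => (Pi.single i (g x) : Fin k → ℕ) := by
  rw [Primrec.fin_curry]
  exact (Primrec.ite (Primrec.eq.comp Primrec.snd (Primrec.const i)) (hg.comp Primrec.fst)
    (Primrec.const 0)).of_eq fun x => by simp [Pi.single_apply]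

theorem primrec_three_pow_two_pow : Primrec fun n => 3 ^ 2 ^ n := by
  have hpow : Primrec₂ ((· ^ ·) : ℕ → ℕ → ℕ) := Primrec₂.unpaired'.1 Nat.Primrec.pow
  exact hpow.comp (.const 3) (hpow.comp (.const 2) .id)

namespace VASS

theorem exists_computable_dom_iff_not_language_le {k : ℕ} (hk : 2 ≤ k) {f : ℕ →. ℕ}
    (hf : Partrec f) :
    ∃ (m p : ℕ) (A : ℕ → VASS k (Fin m) (Fin p)) (B : ℕ → VASS k (Fin m) (Fin 2)),
      Computable (fun n => (A n).toCode) ∧ Computable (fun n => (B n).toCode) ∧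
        ∀ n, (A n).Deterministic ∧ ((f n).Dom ↔ ¬ (A n).language ≤ (B n).language) := by
  let op := (Fintype.equivFin (CounterOp k)).symm
  have hne : (⟨0, by omega⟩ : Fin k) ≠ ⟨1, by omega⟩ := by simp
  obtain ⟨R, ⟨L, ⟨Q, _, M', hM'⟩, hR⟩, hdom⟩ :=
    (registerClosed_strictStep op.surjective).exists_simulates_partrec hne hf
  let M := DFA.reindex (Fintype.equivFin Q) M'
  have hM : M.accepts = L := (DFA.accepts_reindex _ _).trans hM'
  let eff a := (op a).effect
  let test a := (op a).tested
  let c (n : ℕ) : Fin k → ℕ := Pi.single ⟨0, by omega⟩ (3 ^ 2 ^ n)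
  have hc : Computable c := (primrec_pi_single _ primrec_three_pow_two_pow).to_comp
  refine ⟨_, _, fun n => ofDFA M eff (c n), fun n => cheats eff test (c n),
    computable_toCode_init (ofDFA M eff 0) ((Computable.const M.start).pair hc),
    computable_toCode_init (cheats eff test 0) ((Computable.const 0).pair hc),
    fun n => ⟨deterministic_ofDFA, ?_⟩⟩
  rw [language_ofDFA_le_cheats_iff, not_not, hM, hdom]
  simp only [hR]
  exact ⟨fun ⟨d, w, hw, h⟩ => ⟨w, hw, d, h⟩, fun ⟨w, hw, d, h⟩ => ⟨d, w, hw, h⟩⟩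

end VASS

theorem corollary5_general {k : ℕ} (hk : 2 ≤ k) :
    ∃ m p : ℕ, ¬ ∃ decider : VASS.Code k × VASS.Code k →. Bool, Partrec decider ∧
      ∀ (A : VASS k (Fin m) (Fin p)) (B : VASS k (Fin m) (Fin 2)) (a b : VASS.Code k),
        A.IsCode a → B.IsCode b → A.Deterministic →
        ∃ answer ∈ decider (a, b), (answer = true ↔ A.language ≤ B.language) := by
  obtain ⟨f, hf, hundec⟩ := exists_partrec_not_computablePred_dom
  obtain ⟨m, p, A, B, hA, hB, hAB⟩ := VASS.exists_computable_dom_iff_not_language_le hk hf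
  refine ⟨m, p, fun ⟨decider, hdec, hspec⟩ => hundec ?_⟩
  choose answer hmem hiff using fun n =>
    hspec (A n) (B n) _ _ (VASS.isCode_toCode _) (VASS.isCode_toCode _) (hAB n).1
  have hanswer : Computable answer :=
    Partrec.of_eq (hdec.comp (hA.pair hB)) fun n => Part.eq_some_iff.2 (hmem n)
  refine ComputablePred.computable_iff.2
    ⟨fun n => !answer n, Primrec.not.to_comp.comp hanswer, funext fun n => propext ?_⟩
  rw [(hAB n).2, ← hiff]
  simp

end Undecidability

/-- No algorithm (partial computable function) halts with the correct answer to the question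
whether `L(A) ⊆ L(B)` on all inputs that describe an unambiguous 2-VASS `A` and an arbitrary
(nondeterministic) 2-VASS `B` over the same finite alphabet. Nothing is required of the algorithm
on other inputs. -/
theorem corollary5 :
    ¬ ∃ decider : VASS.Code 2 × VASS.Code 2 →. Bool, Partrec decider ∧
      ∀ (m p q : ℕ) (A : VASS 2 (Fin m) (Fin p)) (B : VASS 2 (Fin m) (Fin q))
        (a b : VASS.Code 2), A.IsCode a → B.IsCode b → A.Unambiguous →
        ∃ answer ∈ decider (a, b), (answer = true ↔ A.language ≤ B.language) := by
  rintro ⟨decider, hdec, hspec⟩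
  obtain ⟨m, p, h⟩ := corollary5_general le_rfl
  exact h ⟨decider, hdec, fun A B a b ha hb hA => hspec m p 2 A B a b ha hb hA.unambiguous⟩
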